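/- For a Lie algebra $\mathfrak g$, let $B(\mathfrak g)$ denote the largest ideal $\mathfrak a$ of $\mathfrak g$ with the property: for all $x\in\mathfrak g$, if $[x,[x,\mathfrak a]]=0$ then $[x,\mathfrak a]=0$. (A largest such ideal exists, since a sum of ideals with this property again has it.) Let $p$ be a prime, let $\mathfrak s$ be a finite-dimensional split semisimple Lie algebra over $\mathbb Q_p$ (such an $\mathfrak s$ is automatically algebraic), let $\mathfrak h$ be a splitting Cartan subalgebra with root system $\Phi$ and root space decomposition $\mathfrak s=\mathfrak h\oplus\bigoplus_{\alpha\in\Phi}\mathfrak s_\alpha$, let $\Phi^+\subseteq\Phi$ be the set of positive roots with respect to a base of $\Phi$, and let $\mathfrak g=\mathfrak n^+=\bigoplus_{\alpha\in\Phi^+}\mathfrak s_\alpha$ be the corresponding positive nilpotent subalgebra. If no irreducible component of $\Phi$ is of type $C_n$ with $n\ge 2$ (where $C_2=B_2$), then $B(\mathfrak g)=Z(\mathfrak g)$, the centre of $\mathfrak g$. -/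

import Mathlib

namespace NilpotentControl

open LieAlgebra LieAlgebra.IsKilling

section MaximalIdeal

/-- The condition on an ideal `𝔞` of a Lie algebra `𝔤`:
for all `x ∈ 𝔤`, if `[x, [x, 𝔞]] = 0` then `[x, 𝔞] = 0`. -/
def DoubleBracketCondition {K 𝔤 : Type*} [CommRing K] [LieRing 𝔤] [LieAlgebra K 𝔤]
    (𝔞 : LieIdeal K 𝔤) : Prop :=
  ∀ x : 𝔤, (∀ a ∈ 𝔞, ⁅x, ⁅x, a⁆⁆ = 0) → ∀ a ∈ 𝔞, ⁅x, a⁆ = 0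

/-- The ideal `B(𝔤)`: the largest ideal of `𝔤` satisfying the double bracket condition. It is
defined as the sum of all such ideals; `bIdeal_isGreatest` shows that it is the largest one. -/
def bIdeal (K 𝔤 : Type*) [CommRing K] [LieRing 𝔤] [LieAlgebra K 𝔤] : LieIdeal K 𝔤 :=
  sSup {𝔞 : LieIdeal K 𝔤 | DoubleBracketCondition 𝔞}

theorem bIdeal_isGreatest (K 𝔤 : Type*) [CommRing K] [LieRing 𝔤] [LieAlgebra K 𝔤] :
    IsGreatest {𝔞 : LieIdeal K 𝔤 | DoubleBracketCondition 𝔞} (bIdeal K 𝔤) := by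
  refine ⟨?_, fun 𝔞 h𝔞 => le_sSup h𝔞⟩
  intro x hx a ha
  have key : (bIdeal K 𝔤).toSubmodule ≤ LinearMap.ker (LieAlgebra.ad K 𝔤 x : 𝔤 →ₗ[K] 𝔤) := by
    rw [bIdeal, LieSubmodule.sSup_toSubmodule]
    refine sSup_le ?_
    rintro _ ⟨𝔞, h𝔞, rfl⟩ y hy
    exact h𝔞 x (fun b hb => hx b ((le_sSup h𝔞 : 𝔞 ≤ bIdeal K 𝔤) hb)) y hy
  exact key ha

end MaximalIdeal

section PositivePart

variable {K 𝔰 : Type*} [Field K] [CharZero K] [LieRing 𝔰] [LieAlgebra K 𝔰]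
  [FiniteDimensional K 𝔰] [IsKilling K 𝔰]
  {H : LieSubalgebra K 𝔰} [H.IsCartanSubalgebra] [LieModule.IsTriangularizable K H 𝔰]

/-- The positive nilpotent subalgebra `𝔫⁺ = ⨁_{α ∈ Φ⁺} 𝔰_α` of `𝔰`, where `Φ` is the root system
of `𝔰` relative to the splitting Cartan subalgebra `H`, `Φ⁺` is the set of roots that are positive
relative to the base `b` of `Φ`, and `𝔰_α` is the root space of `α`. -/
def positiveNilpotentSubalgebra (b : (rootSystem H).Base) : LieSubalgebra K 𝔰 where
  toSubmodule := ⨆ α : {α : H.root // b.IsPos α}, (rootSpace H (α.1.1 : H → K)).toSubmodule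
  lie_mem' := by
    intro x y hx hy
    simp only [AddSubsemigroup.mem_carrier, AddSubmonoid.mem_toSubsemigroup,
      Submodule.mem_toAddSubmonoid] at hx hy ⊢
    induction hx using Submodule.iSup_induction' with
    | zero => simp
    | add u v _ _ hu hv => rw [add_lie]; exact add_mem hu hv
    | mem α u hu =>
      induction hy using Submodule.iSup_induction' with
      | zero => simp
      | add v w _ _ hv hw => rw [lie_add]; exact add_mem hv hw
      | mem β v hv =>
        have huv : ⁅u, v⁆ ∈ rootSpace H ((α.1.1 : H → K) + (β.1.1 : H → K)) :=
          lie_mem_genWeightSpace_of_mem_genWeightSpace hu hv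
        by_cases hne : rootSpace H ((α.1.1 : H → K) + (β.1.1 : H → K)) = ⊥
        · rw [hne, LieSubmodule.mem_bot] at huv
          rw [huv]
          exact zero_mem _
        · by_cases hz : (α.1.1 : H → K) + (β.1.1 : H → K) = 0
          · exfalso
            have hroot : (rootSystem H).root α.1 = (rootSystem H).root β.1 +
                (-2 : ℤ) • (rootSystem H).root β.1 := by
              ext h
              have := congr_fun hz h
              simp only [Pi.add_apply, Pi.zero_apply] at this
              simp
              linear_combination this
            have hh := b.height_add_zsmul hroot
            have h1 : 0 < b.height α.1 := α.2
            have h2 : 0 < b.height β.1 := β.2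
            simp only [smul_eq_mul] at hh
            linarith
          · let γ : LieModule.Weight K H 𝔰 := ⟨(α.1.1 : H → K) + (β.1.1 : H → K), hne⟩
            have hγ : γ ∈ H.root := by
              rw [LieSubalgebra.root, Finset.mem_filter]
              exact ⟨Finset.mem_univ _, hz⟩
            have hpos : b.IsPos ⟨γ, hγ⟩ := by
              refine RootPairing.Base.IsPos.add α.2 β.2 ?_
              ext h
              rfl
            exact Submodule.mem_iSup_of_mem
              (p := fun α : {α : H.root // b.IsPos α} =>
                (rootSpace H (α.1.1 : H → K)).toSubmodule) ⟨⟨γ, hγ⟩, hpos⟩ huv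

end PositivePart

/-- `A` is the Cartan matrix `A i j = ⟨αᵢ, αⱼ^∨⟩` of a reduced root system relative to a base. This
says that the root system has an irreducible component of type `Cₙ` for some `n ≥ 2`: there are `n`
distinct simple roots, orthogonal to all the other simple roots (a union of connected components of
the Dynkin diagram), whose Cartan matrix is the (indecomposable) Cartan matrix of type `Cₙ`, with
the single long simple root in the last place. Note that `C₂ = B₂` is included, and that
`C₁ = A₁` is not regarded as being of type `C`. -/
def HasComponentOfTypeC {ι : Type*} (A : Matrix ι ι ℤ) : Prop :=
  ∃ (n : ℕ) (f : Fin n ↪ ι), 2 ≤ n ∧ A.submatrix f f = CartanMatrix.C n ∧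
    ∀ i, ∀ k ∉ Set.range f, A (f i) k = 0 ∧ A k (f i) = 0

end NilpotentControl

/-!
The centre always satisfies the double bracket condition, so the point is that every ideal `𝔞` of
`𝔫⁺` satisfying it is central. If `α` is a long positive root and `e ∈ 𝔰_α`, then `β + 2α` is not a
root for `β` positive, so `[e, [e, 𝔫⁺]] = 0` (`lie_lie_eq_zero_of_isLong`) and the condition forces
`[e, 𝔞] = 0`. It is therefore enough to find, for non-central `𝔞`, a long simple root `α` with
`[𝔰_α, 𝔞] ≠ 0`.

Elements of `𝔫⁺` are detected by pairing them, through the Killing form `κ`, with the root spaces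
`𝔰_{-θ}`, `θ` positive. Take `θ` of maximal height such that `κ(f, [x, y]) ≠ 0` for some
`f ∈ 𝔰_{-θ}`, some positive root vector `x` and some `y ∈ 𝔞`. Invariance of `κ` and
`[𝔰_α, 𝔰_β] = 𝔰_{α+β}` show that `θ` is the highest root of its component, that `x` may be taken in
a simple root space `𝔰_α`, and that `θ - α` is a root (`exists_simple_lie_ne_zero`). No torus action
on `𝔞` is needed.

It remains to see that `α` is long unless the component of `θ` has type `Cₙ`, `n ≥ 2`
(`isLong_of_not_hasComponentOfTypeC`). The root `θ` is long. If `⟨θ, α^∨⟩ = 1`, then `α` is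
conjugate to `-θ`, hence long. Otherwise `∑ cₖ⟨αₖ, θ^∨⟩ = 2`, for `θ = ∑ cₖαₖ`, leaves only the possibility
that `⟨θ, α^∨⟩ = 2 = c_α` and that `θ` is orthogonal to the other simple roots of its component
(`eq_two_of_isLong`). Then `θ = 2α + θ'` with `θ'` of the same nature and of smaller support, and
induction reads off the Cartan matrix of type `C` from `θ = 2α₀ + ⋯ + 2αₙ₋₁ + αₙ`
(`exists_submatrix_eq_C`).
-/

/-! ### Long roots -/

namespace RootPairing

variable {ι K M N : Type*} [Field K] [CharZero K] [AddCommGroup M] [Module K M]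
  [AddCommGroup N] [Module K N] {P : RootPairing ι K M N} [P.IsCrystallographic]

lemma pairingIn_int_eq_sum {κ : Type*} [Fintype κ] {c : κ → ℤ} {r : κ → ι} {γ : ι}
    (h : P.root γ = ∑ k, c k • P.root (r k)) (j : ι) :
    P.pairingIn ℤ γ j = ∑ k, c k * P.pairingIn ℤ (r k) j := by
  apply FaithfulSMul.algebraMap_injective ℤ K
  simp_rw [algebraMap_pairingIn, map_sum, map_mul, algebraMap_pairingIn, ← root_coroot_eq_pairing,
    h, map_sum, map_zsmul, LinearMap.coe_sum, Finset.sum_apply, LinearMap.smul_apply]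
  simp

lemma pairingIn_int_sub_zsmul {i j k : ι} {m : ℤ} (h : P.root k = P.root i - m • P.root j)
    (l : ι) : P.pairingIn ℤ k l = P.pairingIn ℤ i l - m * P.pairingIn ℤ j l := by
  apply FaithfulSMul.algebraMap_injective ℤ K
  simp_rw [map_sub, map_mul, algebraMap_pairingIn, ← root_coroot_eq_pairing, h, map_sub,
    map_zsmul, LinearMap.sub_apply, LinearMap.smul_apply]
  simp

omit [CharZero K] in
lemma root_reflectionPerm_int (i j : ι) :
    P.root (P.reflectionPerm j i) = P.root i - P.pairingIn ℤ i j • P.root j := by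
  rw [root_reflectionPerm, reflection_apply_root' ℤ]

variable (P) in
/-- A root `γ` is *long* if it pairs to `0` or `±1` with every root other than `±γ`, the coroot
being taken on the side of `γ`. When `γ` lies in a component of a reduced crystallographic root
system this says that `γ` has maximal length in that component; the present form avoids the choice
of an invariant inner product. -/
def IsLong (γ : ι) : Prop :=
  ∀ β, P.root β ≠ P.root γ → P.root β ≠ -P.root γ → |P.pairingIn ℤ β γ| ≤ 1

lemma IsLong.reflectionPerm {γ : ι} (h : P.IsLong γ) (j : ι) :
    P.IsLong (P.reflectionPerm j γ) := by
  intro β h₁ h₂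
  rw [pairingIn_reflectionPerm]
  refine h _ (fun h' ↦ h₁ ?_) (fun h' ↦ h₂ ?_)
  · rw [root_reflectionPerm] at h' ⊢
    rw [← h', reflection_same]
  · rw [root_reflectionPerm] at h' ⊢
    rw [← map_neg, ← h', reflection_same]

/-- A root `θ` with `⟨θ, α^∨⟩ = ⟨α, θ^∨⟩ = 1` is conjugate to `-α`, so `α` is long if `θ` is. -/
lemma IsLong.of_pairingIn_eq_one {θ α : ι} (h : P.IsLong θ) (h₁ : P.pairingIn ℤ θ α = 1)
    (h₂ : P.pairingIn ℤ α θ = 1) : P.IsLong α := by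
  have h₃ := ((h.reflectionPerm α).reflectionPerm θ).reflectionPerm α
  have h₄ : P.reflectionPerm θ (P.reflectionPerm α θ) = P.reflectionPerm α α := by
    apply P.root.injective
    have e := root_reflectionPerm_int (P := P) θ α
    rw [root_reflectionPerm_int (P := P) (P.reflectionPerm α θ), pairingIn_int_sub_zsmul e,
      e, h₁, h₂, root_reflectionPerm_int (P := P), pairingIn_same, pairingIn_same]
    module
  rwa [h₄, reflectionPerm_self] at h₃

/-- A long root only occurs in root strings of length at most one, other than its own. -/
lemma IsLong.add_two_zsmul_notMem {α γ : ι} [Finite ι] [P.IsReduced]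
    (h : P.IsLong α) (h₁ : P.root γ ≠ -P.root α) :
    P.root γ + (2 : ℤ) • P.root α ∉ Set.range P.root := by
  rintro ⟨ρ, hρ⟩
  have e := pairingIn_int_sub_zsmul (P := P) (i := γ) (j := α) (k := ρ) (m := -2)
    (by rw [hρ]; module) α
  rw [pairingIn_same] at e
  have bd (β : ι) : |P.pairingIn ℤ β α| ≤ 3 := by
    have := P.pairingIn_pairingIn_mem_set_of_isCrystal_of_isRed β α
    simp only [Set.mem_insert_iff, Set.mem_singleton_iff, Prod.mk.injEq] at this
    rw [abs_le]
    rcases this with h | h | h | h | h | h | h | h | h | h | h | h | h <;> rw [h.1] <;> norm_num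
  have b₁ := abs_le.mp (bd ρ)
  have b₂ := abs_le.mp (bd γ)
  have hγ : P.root γ ≠ P.root α := by
    intro h'
    rw [P.root.injective h', pairingIn_same] at e
    lia
  have hρ₁ : P.root ρ ≠ P.root α := by
    intro h'
    apply h₁
    rw [h', ← sub_eq_iff_eq_add] at hρ
    rw [← hρ]
    module
  have hρ₂ : P.root ρ ≠ -P.root α := by
    intro h'
    rw [P.root_eq_neg_iff.mp h', pairingIn_reflectionPerm_self_left, pairingIn_same] at e
    lia
  have l₁ := abs_le.mp (h γ hγ h₁)
  have l₂ := abs_le.mp (h ρ hρ₁ hρ₂)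
  lia

/-! ### Highest roots and type `C` -/

namespace Base

/-- The Cartan matrix of type `C` grows by a node placed in front of its first node; the last node
carries the long simple root, so the new entries are unusual only if the old matrix has size one. -/
lemma submatrix_cons_eq_C {κ : Type*} {A : Matrix κ κ ℤ} {n : ℕ} {f : Fin (n + 1) → κ} {i : κ}
    (hi : A i i = 2) (hf : A.submatrix f f = CartanMatrix.C (n + 1))
    (hrow : ∀ k, A i (f k) = if k = 0 then -1 else 0)
    (hcol : ∀ k, A (f k) i = if k = 0 then if n = 0 then -2 else -1 else 0) :
    A.submatrix (Fin.cons i f : Fin (n + 2) → κ) (Fin.cons i f : Fin (n + 2) → κ) =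
      CartanMatrix.C (n + 2) := by
  ext a a'
  rw [Matrix.submatrix_apply]
  cases a using Fin.cases with
  | zero =>
    cases a' using Fin.cases with
    | zero => simpa [CartanMatrix.C] using hi
    | succ a' =>
      simp only [Fin.cons_zero, Fin.cons_succ, hrow, CartanMatrix.C, Matrix.of_apply, Fin.ext_iff,
        Fin.val_succ, Fin.val_zero]
      split_ifs <;> first | contradiction | omega
  | succ a =>
    cases a' using Fin.cases with
    | zero =>
      simp only [Fin.cons_zero, Fin.cons_succ, hcol, CartanMatrix.C, Matrix.of_apply, Fin.ext_iff,
        Fin.val_succ, Fin.val_zero]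
      split_ifs <;> first | contradiction | omega
    | succ a' =>
      have h₁ : A (f a) (f a') = _ := congrFun (congrFun hf a) a'
      simp only [Fin.cons_succ, h₁, CartanMatrix.C, Matrix.of_apply, Fin.ext_iff, Fin.val_succ]
      split_ifs <;> first | contradiction | omega

variable (b : P.Base)

omit [P.IsCrystallographic] in
lemma eq_of_sum_root_eq {c d : b.support → ℤ}
    (h : ∑ k, c k • P.root k = ∑ k, d k • P.root k) : c = d :=
  funext <| Fintype.linearIndependent_iffₛ.mp (b.linearIndepOn_root.restrict_scalars' ℤ) c d h

variable {b}

omit [P.IsCrystallographic] in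
lemma IsPos.exists_root_eq_sum {γ : ι} (h : b.IsPos γ) :
    ∃ c : b.support → ℤ, (∀ k, 0 ≤ c k) ∧ P.root γ = ∑ k, c k • P.root k := by
  obtain ⟨f, -, hf, h'⟩ := b.exists_root_eq_sum_int γ
  refine ⟨fun k ↦ f k, ?_, ?_⟩
  · rcases hf with hf | hf
    · exact fun k ↦ hf.le k
    · have := height_eq_sum h'
      have h2 : ∑ j ∈ b.support, f j ≤ 0 := Finset.sum_nonpos fun j _ ↦ hf.le j
      rw [isPos_iff] at h
      lia
  · rw [h', ← Finset.sum_coe_sort b.support (fun j ↦ f j • P.root j)]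

variable [Finite ι] [P.IsReduced]

/-- A root `θ` such that `θ + δ` is never a root, for `δ` positive, is long: if `⟨β, θ^∨⟩ ≥ 2` then
`δ = β - θ` and `β - 2θ = -(θ + (-δ))` are roots, and one of `δ`, `-δ` is positive. -/
lemma isLong_of_forall_add_notMem {θ : ι}
    (hmax : ∀ δ, b.IsPos δ → P.root θ + P.root δ ∉ Set.range P.root) : P.IsLong θ := by
  classical
  let := P.indexNeg
  have key (β : ι) (h₁ : P.root β ≠ P.root θ) (h₂ : P.root β ≠ -P.root θ) :
      P.pairingIn ℤ β θ ≤ 1 := by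
    by_contra! hβ
    have hβθ : β ≠ θ := fun h ↦ h₁ (by rw [h])
    have hli : LinearIndependent K ![P.root θ, P.root β] :=
      IsReduced.linearIndependent P hβθ.symm fun h ↦ h₂ (by rw [h, neg_neg])
    have hs : P.root β - P.pairingIn ℤ β θ • P.root θ ∈ Set.range P.root :=
      ⟨_, root_reflectionPerm_int β θ⟩
    rw [root_sub_zsmul_mem_range_iff hli, Set.mem_Icc] at hs
    have h2 : P.root β - (2 : ℤ) • P.root θ ∈ Set.range P.root := by
      rw [root_sub_zsmul_mem_range_iff hli, Set.mem_Icc]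
      lia
    obtain ⟨δ, hδ⟩ := P.root_sub_root_mem_of_pairingIn_pos (by lia) hβθ
    rcases IsPos.or_neg b δ with hp | hp
    · exact hmax δ hp ⟨β, by rw [hδ]; abel⟩
    · refine hmax _ hp ?_
      rw [← neg_mem_range_root_iff]
      convert h2 using 1
      rw [indexNeg_neg, root_reflectionPerm, reflection_apply_self, hδ]
      module
  intro β h₁ h₂
  rw [abs_le]
  refine ⟨?_, key β h₁ h₂⟩
  have := key (P.reflectionPerm β β) (by simpa [neg_eq_iff_eq_neg] using h₂)
    (by simpa using h₁)
  rw [pairingIn_reflectionPerm_self_left] at this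
  lia

/-- If a long root `γ = ∑ cₖαₖ` is dominant on its support and pairs to at least `2` with the coroot
of some other simple root `αᵢ`, then `γ = 2αᵢ + γ'`, where `γ'` is a root whose support is that of
`γ` without `i`, and all the other simple roots in the support are orthogonal to `γ`. The reason is
that `∑ cₖ⟨αₖ, γ^∨⟩ = 2`, while `cᵢ ≥ ⟨γ, αᵢ^∨⟩` because `γ - ⟨γ, αᵢ^∨⟩αᵢ` is a positive root. -/
lemma eq_two_of_isLong {γ : ι} {c : b.support → ℤ} (hc : ∀ k, 0 ≤ c k)
    (hγ : P.root γ = ∑ k, c k • P.root k) (hpos : b.IsPos γ)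
    (hdom : ∀ k, c k ≠ 0 → 0 ≤ P.pairingIn ℤ γ k) {i : b.support} (hi : γ ≠ i)
    (h2 : 2 ≤ P.pairingIn ℤ γ i) :
    P.pairingIn ℤ γ i = 2 ∧ c i = 2 ∧ ∀ k, c k ≠ 0 → k ≠ i → P.pairingIn ℤ γ k = 0 := by
  classical
  have hi' : 1 ≤ P.pairingIn ℤ i γ := by
    have := P.zero_lt_pairingIn_iff' (S := ℤ) (i := γ) (j := i)
    lia
  obtain ⟨d, hd, hd'⟩ := (hpos.reflectionPerm i.2 hi).exists_root_eq_sum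
  have hd'' : d = c - Pi.single i (P.pairingIn ℤ γ i) := by
    apply b.eq_of_sum_root_eq
    rw [← hd', root_reflectionPerm_int]
    simp [sub_smul, Finset.sum_sub_distrib, hγ, Pi.single_apply, ite_smul]
  have hdi := hd i
  rw [hd''] at hdi
  simp only [Pi.sub_apply, Pi.single_eq_same] at hdi
  have hsum := pairingIn_int_eq_sum (r := fun k : b.support ↦ (k : ι)) hγ γ
  rw [pairingIn_same] at hsum
  have hnn (k : b.support) : 0 ≤ c k * P.pairingIn ℤ k γ := by
    by_cases hk : c k = 0
    · simp [hk]
    · refine mul_nonneg (hc k) ?_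
      have := hdom k hk
      have := P.zero_lt_pairingIn_iff' (S := ℤ) (i := γ) (j := k)
      have := P.pairingIn_eq_zero_iff (S := ℤ) (i := γ) (j := k)
      lia
  have hle : c i * P.pairingIn ℤ i γ ≤ 2 :=
    hsum ▸ Finset.single_le_sum (fun k _ ↦ hnn k) (Finset.mem_univ i)
  have hci : c i = 2 := by nlinarith
  refine ⟨by lia, hci, fun k hk hki ↦ ?_⟩
  have hle2 : c i * P.pairingIn ℤ i γ + c k * P.pairingIn ℤ k γ ≤ 2 := by
    rw [← Finset.sum_pair (f := fun j : b.support ↦ c j * P.pairingIn ℤ j γ) hki.symm, hsum]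
    exact Finset.sum_le_sum_of_subset_of_nonneg (Finset.subset_univ _) fun j _ _ ↦ hnn j
  have h0 : c k * P.pairingIn ℤ k γ = 0 := le_antisymm (by nlinarith) (hnn k)
  rcases mul_eq_zero.mp h0 with h | h
  · exact absurd h hk
  · exact (P.pairingIn_eq_zero_iff (S := ℤ)).mp h

/-- If all the numbers `⟨γ, αₖ^∨⟩`, for `αₖ` in the support of a long positive root `γ`, are even
and non-negative, then `γ = 2α₀ + ⋯ + 2αₙ₋₁ + αₙ` where `α₀, …, αₙ` are the simple roots of a diagram of
type `Cₙ₊₁` (which is `A₁` if `n = 0`). By induction on the size of the support: splitting off `2αᵢ`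
as in `eq_two_of_isLong` leaves a root of the same kind. -/
lemma exists_submatrix_eq_C (n : ℕ) {γ : ι} {c : b.support → ℤ} (hc : ∀ k, 0 ≤ c k)
    (hγ : P.root γ = ∑ k, c k • P.root k) (hpos : b.IsPos γ) (hlong : P.IsLong γ)
    (hdom : ∀ k, c k ≠ 0 → 0 ≤ P.pairingIn ℤ γ k ∧ Even (P.pairingIn ℤ γ k))
    (hn : Finset.card {k | c k ≠ 0} = n + 1) :
    ∃ f : Fin (n + 1) → b.support, f.Injective ∧ (∀ k, c k ≠ 0 ↔ k ∈ Set.range f) ∧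
      b.cartanMatrix.submatrix f f = CartanMatrix.C (n + 1) ∧
      (∀ k, P.pairingIn ℤ γ (f k) = if k = 0 then 2 else 0) ∧
      c (f 0) = if n = 0 then 1 else 2 := by
  classical
  have : IsAddTorsionFree M := .of_isTorsionFree K M
  have : IsAddTorsionFree N := .of_isTorsionFree K N
  induction n generalizing γ c with
  | zero =>
    have : Subsingleton (Fin (0 + 1)) := inferInstanceAs (Subsingleton (Fin 1))
    obtain ⟨i, hi⟩ := Finset.card_eq_one.mp hn
    have hi' (k) : c k ≠ 0 ↔ k = i := by simpa using Finset.ext_iff.mp hi k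
    have hγi : P.root γ = c i • P.root i := by
      rw [hγ, Finset.sum_eq_single i (fun k _ hk ↦ ?_) (by simp)]
      rw [not_ne_iff.mp ((hi' k).not.mpr hk), zero_smul]
    have hci : c i = 1 := by
      have := b.eq_one_or_neg_one_of_mem_support_of_smul_mem i i.2 (c i : K)
        ⟨γ, by rw [hγi, Int.cast_smul_eq_zsmul]⟩
      norm_cast at this
      have := hc i
      lia
    have hγi' : γ = i := P.root.injective (by rw [hγi, hci, one_smul])
    refine ⟨fun _ ↦ i, Function.injective_of_subsingleton _, ?_, ?_, ?_, by simpa using hci⟩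
    · simpa [eq_comm] using hi'
    · ext a a'
      simp [CartanMatrix.C, Subsingleton.elim a a']
    · intro k
      simp [hγi', Subsingleton.elim k 0]
  | succ n ih =>
    have hne (i : b.support) : γ ≠ i := by
      rintro rfl
      have : c = Pi.single i 1 := by
        apply b.eq_of_sum_root_eq
        rw [← hγ]
        simp [Pi.single_apply, ite_smul]
      have : Finset.card {k | c k ≠ 0} = 1 := Finset.card_eq_one.mpr ⟨i, by
        ext k
        simp [this, Pi.single_apply]⟩
      lia
    obtain ⟨i, hi₀, hi₂⟩ : ∃ i : b.support, c i ≠ 0 ∧ 2 ≤ P.pairingIn ℤ γ i := by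
      by_contra! hcon
      have hsum := pairingIn_int_eq_sum (r := fun k : b.support ↦ (k : ι)) hγ γ
      have : ∑ k, c k * P.pairingIn ℤ k γ ≤ 0 := by
        refine Finset.sum_nonpos fun k _ ↦ ?_
        by_cases hk : c k = 0
        · simp [hk]
        · refine mul_nonpos_of_nonneg_of_nonpos (hc k) ?_
          have := hcon k hk
          obtain ⟨-, m, hm⟩ := hdom k hk
          have := P.zero_lt_pairingIn_iff' (S := ℤ) (i := γ) (j := k)
          lia
      rw [pairingIn_same] at hsum
      lia
    obtain ⟨hγi, hci, hγk⟩ :=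
      eq_two_of_isLong hc hγ hpos (fun k hk ↦ (hdom k hk).1) (hne i) hi₂
    set γ' := P.reflectionPerm i γ
    have hrt : P.root γ' = P.root γ - (2 : ℤ) • P.root i := by
      rw [root_reflectionPerm_int, hγi]
    set c' := Function.update c i 0 with hc'
    have hc'_eq : c' = c - Pi.single i 2 := by
      ext k
      rcases eq_or_ne k i with rfl | hk <;> simp [*]
    have hc'_ne (k) : c' k ≠ 0 ↔ c k ≠ 0 ∧ k ≠ i := by
      rcases eq_or_ne k i with rfl | hk <;> simp [*]
    have hγ' : P.root γ' = ∑ k, c' k • P.root k := by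
      rw [hrt, hγ, hc'_eq]
      simp [sub_smul, Finset.sum_sub_distrib, Pi.single_apply, ite_smul]
    have hpair (k : b.support) : P.pairingIn ℤ γ' k = P.pairingIn ℤ γ k - 2 * P.pairingIn ℤ i k :=
      pairingIn_int_sub_zsmul hrt k
    obtain ⟨f, hf_inj, hf_range, hf_mat, hf_pair, hf_zero⟩ := ih (γ := γ') (c := c')
      (fun k ↦ by rcases eq_or_ne k i with rfl | hk <;> simp [*]) hγ'
      (hpos.reflectionPerm i.2 (hne i)) (hlong.reflectionPerm i)
      (fun k hk ↦ by
        rw [hc'_ne] at hk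
        have := b.pairingIn_le_zero_of_ne (Subtype.coe_ne_coe.mpr hk.2.symm) i.2 k.2
        rw [hpair, hγk k hk.1 hk.2]
        exact ⟨by lia, -P.pairingIn ℤ i k, by ring⟩)
      (by
        have : ({k | c' k ≠ 0} : Finset b.support) = Finset.erase {k | c k ≠ 0} i := by
          ext k
          simp [hc'_ne, and_comm]
        rw [this, Finset.card_erase_of_mem (by simpa using hi₀), hn]
        rfl)
    have hf (k) : c (f k) ≠ 0 ∧ f k ≠ i := (hc'_ne _).mp ((hf_range _).mpr ⟨k, rfl⟩)
    -- the row of the Cartan matrix at `i`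
    have hrow (k) : P.pairingIn ℤ i (f k) = if k = 0 then -1 else 0 := by
      have h₁ := hf_pair k
      rw [hpair, hγk _ (hf k).1 (hf k).2] at h₁
      split_ifs at h₁ ⊢ <;> lia
    have hcol_ne (k) (hk : k ≠ 0) : P.pairingIn ℤ (f k) i = 0 := by
      rw [P.pairingIn_eq_zero_iff, hrow, if_neg hk]
    -- the remaining entry of its column, from `⟨γ', αᵢ^∨⟩ = -2`
    have hcol_zero : P.pairingIn ℤ (f 0) i = if n = 0 then -2 else -1 := by
      have h₁ := hpair i
      rw [pairingIn_int_eq_sum (r := fun k : b.support ↦ (k : ι)) hγ' i,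
        Finset.sum_eq_single (f 0) (fun k _ hk ↦ ?_) (by simp), hf_zero, hγi, pairingIn_same] at h₁
      · split_ifs at h₁ ⊢ <;> lia
      · by_cases h : c' k = 0
        · rw [h, zero_mul]
        · obtain ⟨l, rfl⟩ := (hf_range k).mp h
          rw [hcol_ne l (by rintro rfl; exact hk rfl), mul_zero]
    refine ⟨Fin.cons i f, Fin.cons_injective_iff.mpr ⟨?_, hf_inj⟩, fun k ↦ ?_, ?_, fun k ↦ ?_,
      by simpa using hci⟩
    · rintro ⟨k, hk⟩
      exact (hf k).2 hk
    · rw [Fin.range_cons, Set.mem_insert_iff, ← hf_range, hc'_ne]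
      rcases eq_or_ne k i with rfl | hk <;> simp [*]
    · refine submatrix_cons_eq_C (b.cartanMatrix_apply_same i) hf_mat hrow fun k ↦ ?_
      rcases eq_or_ne k 0 with rfl | hk
      · rw [if_pos rfl]
        exact hcol_zero
      · rw [if_neg hk]
        exact hcol_ne k hk
    · cases k using Fin.cases with
      | zero => simpa using hγi
      | succ k => simpa [Fin.succ_ne_zero] using hγk _ (hf k).1 (hf k).2

/-- Let `θ` be a positive root such that `θ + δ` is never a root, for `δ` positive (a highest root
of a component). If `θ - αᵢ` is a root, then `αᵢ` is long unless the component has type `C`. -/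
lemma IsPos.isLong_of_not_hasComponentOfTypeC {θ : ι} (hθ : b.IsPos θ)
    (hmax : ∀ δ, b.IsPos δ → P.root θ + P.root δ ∉ Set.range P.root) {i : b.support}
    (hi : P.root θ - P.root i ∈ Set.range P.root)
    (hC : ¬ NilpotentControl.HasComponentOfTypeC b.cartanMatrix) : P.IsLong i := by
  classical
  have hlong := isLong_of_forall_add_notMem hmax
  have hdom (k : b.support) : 0 ≤ P.pairingIn ℤ θ k := by
    by_contra! hk
    refine hmax k (isPos_of_mem_support k.2) (P.root_add_root_mem_of_pairingIn_neg hk fun h ↦ ?_)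
    have := b.height_add_zsmul (i := k) (j := k) (k := θ) (z := -2) (by rw [h]; module)
    have h₁ : 0 < b.height θ := hθ
    rw [height_one_of_mem_support k.2] at this
    lia
  have hne : θ ≠ i := by
    rintro rfl
    rw [sub_self] at hi
    obtain ⟨j, hj⟩ := hi
    exact P.ne_zero j hj
  have hne' : P.root θ ≠ -P.root i := by
    intro h
    have := hdom i
    rw [P.root_eq_neg_iff.mp h, pairingIn_reflectionPerm_self_left, pairingIn_same] at this
    lia
  have hpair : 1 ≤ P.pairingIn ℤ θ i := by
    have hli := IsReduced.linearIndependent P hne.symm fun h ↦ hne' (by rw [h, neg_neg])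
    have h₁ := P.chainBotCoeff_sub_chainTopCoeff (i := i) (j := θ)
    have h₂ := (P.chainTopCoeff_eq_zero_iff (i := i) (j := θ)).mpr
      (.inr (hmax i (isPos_of_mem_support i.2)))
    have h₃ : 1 ≤ P.chainBotCoeff i θ := by
      rwa [← root_sub_nsmul_mem_range_iff_le_chainBotCoeff hli, one_smul]
    lia
  rcases hpair.eq_or_lt with h₁ | h₁
  · refine hlong.of_pairingIn_eq_one h₁.symm ?_
    have h₂ := abs_le.mp (hlong i (fun h ↦ hne (P.root.injective h.symm))
      (fun h ↦ hne' (by rw [h, neg_neg])))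
    have := P.zero_lt_pairingIn_iff' (S := ℤ) (i := θ) (j := i)
    lia
  · refine absurd ?_ hC
    obtain ⟨c, hc, hγ⟩ := hθ.exists_root_eq_sum
    obtain ⟨hi₂, hci, hk⟩ := eq_two_of_isLong hc hγ hθ (fun k _ ↦ hdom k) hne h₁
    have hi_ne : c i ≠ 0 := by lia
    have hcard : 0 < Finset.card {k | c k ≠ 0} := Finset.card_pos.mpr ⟨i, by simpa using hi_ne⟩
    obtain ⟨n, hn⟩ := Nat.exists_eq_add_of_lt hcard
    obtain ⟨f, hf_inj, hf_range, hf_mat, -, hf_zero⟩ := exists_submatrix_eq_C n hc hγ hθ hlong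
      (fun k hck ↦ ⟨hdom k, by
        rcases eq_or_ne k i with rfl | hki
        · simp [hi₂]
        · simp [hk k hck hki]⟩) (by simpa using hn)
    refine ⟨n + 1, ⟨f, hf_inj⟩, ?_, hf_mat, fun a k hka ↦ ?_⟩
    · -- a single node is excluded, as its coefficient would be `1` while `cᵢ = 2`
      rcases Nat.eq_zero_or_pos n with rfl | hn'
      · obtain ⟨a, ha⟩ := (hf_range i).mp hi_ne
        have : Subsingleton (Fin (0 + 0 + 1)) := inferInstanceAs (Subsingleton (Fin 1))
        rw [Subsingleton.elim a 0] at ha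
        rw [ha, hci] at hf_zero
        simp at hf_zero
      · lia
    · -- `⟨θ, αₖ^∨⟩` is non-negative, and a sum of non-positive terms for `k` outside the support
      have hck : c k = 0 := by
        by_contra h
        exact hka ((hf_range k).mp h)
      have hnonpos (j : b.support) : c j * P.pairingIn ℤ j k ≤ 0 := by
        rcases eq_or_ne j k with rfl | hjk
        · simp [hck]
        · exact mul_nonpos_of_nonneg_of_nonpos (hc j)
            (b.pairingIn_le_zero_of_ne (Subtype.coe_ne_coe.mpr hjk) j.2 k.2)
      have hsum := hdom k
      rw [pairingIn_int_eq_sum (r := fun k : b.support ↦ (k : ι)) hγ] at hsum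
      have := (Finset.sum_eq_zero_iff_of_nonpos fun j _ ↦ hnonpos j).mp
        (le_antisymm (Finset.sum_nonpos fun j _ ↦ hnonpos j) hsum) (f a) (Finset.mem_univ _)
      have h0 : b.cartanMatrix (f a) k = 0 :=
        (mul_eq_zero.mp this).resolve_left ((hf_range _).mpr ⟨a, rfl⟩)
      exact ⟨h0, b.cartanMatrix_apply_eq_zero_iff_symm.mp h0⟩

end Base
end RootPairing

/-! ### Brackets of root spaces -/

namespace LieAlgebra.IsKilling

open LieModule Weight

variable {K L : Type*} [Field K] [CharZero K] [LieRing L] [LieAlgebra K L]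
  [FiniteDimensional K L] [IsKilling K L]
  {H : LieSubalgebra K L} [H.IsCartanSubalgebra] [IsTriangularizable K H L]

/-- If `α`, `β` and `α + β` are weights, with `α` and `α + β` non-zero, then
`[L_α, L_β] = L_{α+β}`, and in fact every element of `L_{α+β}` is a single bracket. -/
lemma exists_lie_eq_of_mem_rootSpace {α β γ : Weight K H L} (hα : α.IsNonZero) (hγ : γ.IsNonZero)
    (h : (γ : H → K) = α + β) {z : L} (hz : z ∈ rootSpace H γ) :
    ∃ x ∈ rootSpace H α, ∃ y ∈ rootSpace H β, ⁅x, y⁆ = z := by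
  obtain ⟨t, e, f, isSl2, he, hf⟩ := exists_isSl2Triple_of_weight_isNonZero hα.neg
  obtain rfl := isSl2.h_eq_coroot hα.neg he hf
  rw [coe_neg, neg_neg] at hf
  -- move down the `(-α)`-chain through `β` from a primitive vector at its top
  obtain ⟨x, hx, x_ne0⟩ := (chainTop (-α) β).exists_ne_zero
  have prim : isSl2.HasPrimitiveVectorWith x (chainLength (-α) β : K) :=
    have := lie_mem_genWeightSpace_of_mem_genWeightSpace he hx
    ⟨x_ne0, (chainLength_smul _ _ hx).symm, by
      rwa [coe_neg, ← coe_neg, genWeightSpace_add_chainTop _ _ hα.neg] at this⟩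
  set n := chainTopCoeff (-α) β with hn
  have hlen : n + 1 ≤ chainLength (-α) β := by
    have hβγ : (γ : H → K) = (-1 : ℤ) • (-α : Weight K H L) + β := by
      rw [h, coe_neg]; simp
    have h₁ := ((rootSpace_zsmul_add_ne_bot_iff (-α) β hα.neg (-1)).mp
      (by rw [← hβγ]; exact γ.genWeightSpace_ne_bot)).2
    have h₂ := chainTopCoeff_add_chainBotCoeff (-α) β
    lia
  have hy : ((toEnd K L L f) ^ n) x ∈ rootSpace H β := by
    have := toEnd_pow_apply_mem hf hx n
    convert this using 2
    rw [coe_chainTop, ← hn, coe_neg]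
    simp
  have hfy := prim.pow_toEnd_f_ne_zero_of_eq_nat rfl hlen
  rw [pow_succ', Module.End.mul_apply, toEnd_apply_apply] at hfy
  have hmem : ⁅f, ((toEnd K L L f) ^ n) x⁆ ∈ rootSpace H γ := by
    rw [h]
    exact lie_mem_genWeightSpace_of_mem_genWeightSpace hf hy
  obtain ⟨c, hc⟩ := (finrank_eq_one_iff_of_nonzero' (⟨_, hmem⟩ : rootSpace H γ)
    (by simpa using hfy)).mp (finrank_rootSpace_eq_one γ hγ) ⟨z, hz⟩
  refine ⟨f, hf, c • _, Submodule.smul_mem _ c hy, ?_⟩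
  simpa [Subtype.ext_iff] using hc

end LieAlgebra.IsKilling

/-! ### Ideals of the positive nilpotent subalgebra -/

namespace NilpotentControl

open LieAlgebra LieAlgebra.IsKilling LieModule

variable {K 𝔰 : Type*} [Field K] [CharZero K] [LieRing 𝔰] [LieAlgebra K 𝔰]
  [FiniteDimensional K 𝔰] [IsKilling K 𝔰]
  {H : LieSubalgebra K 𝔰} [H.IsCartanSubalgebra] [LieModule.IsTriangularizable K H 𝔰]
  {b : (rootSystem H).Base}

omit [CharZero K] [IsKilling K 𝔰] [LieModule.IsTriangularizable K H 𝔰] in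
lemma exists_root_coe_eq {φ : H → K} (h₀ : φ ≠ 0) (hφ : rootSpace H φ ≠ ⊥) :
    ∃ ρ : H.root, (ρ.1 : H → K) = φ := by
  refine ⟨⟨⟨φ, hφ⟩, ?_⟩, rfl⟩
  rw [LieSubalgebra.root, Finset.mem_filter]
  exact ⟨Finset.mem_univ _, h₀⟩

lemma rootSpace_le_positiveNilpotentSubalgebra {δ : H.root} (hδ : b.IsPos δ) {x : 𝔰}
    (hx : x ∈ rootSpace H (δ.1 : H → K)) : x ∈ positiveNilpotentSubalgebra b :=
  Submodule.mem_iSup_of_mem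
    (p := fun α : {α : H.root // b.IsPos α} ↦ (rootSpace H (α.1.1 : H → K)).toSubmodule) ⟨δ, hδ⟩ hx

lemma positiveNilpotentSubalgebra_induction {p : 𝔰 → Prop} {x : 𝔰}
    (hx : x ∈ positiveNilpotentSubalgebra b)
    (mem : ∀ δ : H.root, b.IsPos δ → ∀ y ∈ rootSpace H (δ.1 : H → K), p y)
    (zero : p 0) (add : ∀ y z, p y → p z → p (y + z)) : p x := by
  replace hx : x ∈ ⨆ α : {α : H.root // b.IsPos α},
    (rootSpace H (α.1.1 : H → K)).toSubmodule := hx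
  exact Submodule.iSup_induction _ (motive := p) hx (fun i y hy ↦ mem i.1 i.2 y hy) zero add

/-- `H` is orthogonal to the positive root spaces. -/
lemma killingForm_eq_zero_of_mem_rootSpace_zero {h y : 𝔰} (hh : h ∈ rootSpace H (0 : H → K))
    (hy : y ∈ positiveNilpotentSubalgebra b) : killingForm K 𝔰 h y = 0 := by
  refine positiveNilpotentSubalgebra_induction (p := fun y ↦ killingForm K 𝔰 h y = 0) hy
    (fun δ _ z hz ↦ ?_) (map_zero _) fun u v hu hv ↦ by rw [map_add, hu, hv, add_zero]
  refine killingForm_apply_eq_zero_of_mem_rootSpace_of_add_ne_zero K 𝔰 H hh hz ?_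
  rw [zero_add]
  exact H.isNonZero_coe_root δ

lemma add_ne_zero_of_isPos {γ δ : H.root} (hγ : b.IsPos γ) (hδ : b.IsPos δ) :
    (γ.1 : H → K) + (δ.1 : H → K) ≠ 0 := by
  intro h
  have := b.height_add_zsmul (i := δ) (j := δ) (k := γ) (z := -2) (by
    ext t
    have := congrFun h t
    simp only [Pi.add_apply, Pi.zero_apply] at this
    simp
    linear_combination this)
  have h₁ : 0 < b.height γ := hγ
  have h₂ : 0 < b.height δ := hδ
  simp only [smul_eq_mul] at this
  lia

/-- The Killing form pairs `𝔫⁺` non-degenerately with the sum of the negative root spaces. -/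
lemma exists_killingForm_ne_zero {y : 𝔰} (hy : y ∈ positiveNilpotentSubalgebra b) (hy₀ : y ≠ 0) :
    ∃ θ : H.root, b.IsPos θ ∧ ∃ f ∈ rootSpace H (-(θ.1 : H → K)), killingForm K 𝔰 f y ≠ 0 := by
  by_contra! hcon
  suffices h : y ∈ LinearMap.ker (killingForm K 𝔰) from hy₀ (by simpa using h)
  rw [LinearMap.mem_ker]
  ext x
  rw [LinearMap.zero_apply, LieModule.traceForm_comm]
  have hx : x ∈ ⨆ β : H → K, rootSpace H β := by simp [iSup_genWeightSpace_eq_top K H 𝔰]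
  induction hx using LieSubmodule.iSup_induction' with
  | zero => simp
  | add u v _ _ hu hv => rw [map_add, LinearMap.add_apply, hu, hv, add_zero]
  | mem β x hx =>
    by_cases hβ : rootSpace H β = ⊥
    · rw [hβ, LieSubmodule.mem_bot] at hx
      simp [hx]
    · by_cases hβ₀ : β = 0
      · subst hβ₀
        exact killingForm_eq_zero_of_mem_rootSpace_zero hx hy
      · obtain ⟨β', rfl⟩ := exists_root_coe_eq hβ₀ hβ
        let := (rootSystem H).indexNeg
        rcases RootPairing.Base.IsPos.or_neg b β' with hp | hp
        · refine positiveNilpotentSubalgebra_induction (p := fun y ↦ killingForm K 𝔰 x y = 0) hy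
            (fun δ hδ z hz ↦ ?_) (map_zero _) fun u v hu hv ↦ by rw [map_add, hu, hv, add_zero]
          exact killingForm_apply_eq_zero_of_mem_rootSpace_of_add_ne_zero K 𝔰 H hx hz
            (add_ne_zero_of_isPos hp hδ)
        · refine hcon _ hp x ?_
          have : ((-β' : H.root).1 : H → K) = -β'.1 := by
            ext t
            exact DFunLike.congr_fun ((rootSystem H).root_eq_neg_iff.mpr rfl :
              (rootSystem H).root ((rootSystem H).reflectionPerm β' β') = _) t
          rwa [this, neg_neg]

/-- If `α` is a long positive root, then `(ad e)² = 0` on `𝔫⁺` for `e ∈ 𝔰_α`, as `β + 2α` is not a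
weight of `𝔰` for `β` positive. -/
lemma lie_lie_eq_zero_of_isLong {α : H.root} (hα : b.IsPos α) (hlong : (rootSystem H).IsLong α)
    {x y : 𝔰} (hx : x ∈ rootSpace H (α.1 : H → K)) (hy : y ∈ positiveNilpotentSubalgebra b) :
    ⁅x, ⁅x, y⁆⁆ = 0 := by
  refine positiveNilpotentSubalgebra_induction (p := fun y ↦ ⁅x, ⁅x, y⁆⁆ = 0) hy
    (fun γ hγ z hz ↦ ?_) (by simp) fun u v hu hv ↦ by rw [lie_add, lie_add, hu, hv, add_zero]
  have hmem : ⁅x, ⁅x, z⁆⁆ ∈ rootSpace H ((α.1 : H → K) + (α.1 + γ.1)) :=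
    lie_mem_genWeightSpace_of_mem_genWeightSpace hx
      (lie_mem_genWeightSpace_of_mem_genWeightSpace hx hz)
  by_contra hne
  have hbot : rootSpace H ((α.1 : H → K) + (α.1 + γ.1)) ≠ ⊥ := fun h ↦ hne (by
    rwa [h, LieSubmodule.mem_bot] at hmem)
  have hγα : (rootSystem H).root γ ≠ -(rootSystem H).root α := fun h ↦
    add_ne_zero_of_isPos hγ hα <| funext fun t ↦ by
      simpa [← eq_neg_iff_add_eq_zero] using congrArg (fun φ : Module.Dual K H ↦ φ t) h
  have h₀ : (α.1 : H → K) + (α.1 + γ.1) ≠ 0 := by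
    intro h
    have := b.height_add_zsmul (i := α) (j := α) (k := γ) (z := -3) (by
      ext t
      have := congrFun h t
      simp only [Pi.add_apply, Pi.zero_apply] at this
      simp
      linear_combination this)
    have h₁ : 0 < b.height γ := hγ
    have h₂ : 0 < b.height α := hα
    simp only [smul_eq_mul] at this
    lia
  obtain ⟨ρ, hρ⟩ := exists_root_coe_eq h₀ hbot
  refine hlong.add_two_zsmul_notMem hγα ⟨ρ, ?_⟩
  ext t
  have := congrFun hρ t
  simp only [Pi.add_apply] at this
  simp
  linear_combination this

/-- Let `S ⊆ 𝔫⁺` be stable under bracketing with the positive root spaces. If `S` does not commute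
with `𝔫⁺`, then it fails to commute with some simple root space `𝔰_α` for which `θ - α` is a root,
`θ` being a highest root of some component. -/
lemma exists_simple_lie_ne_zero {S : Set 𝔰} (hS : ∀ y ∈ S, y ∈ positiveNilpotentSubalgebra b)
    (hlie : ∀ δ : H.root, b.IsPos δ → ∀ x ∈ rootSpace H (δ.1 : H → K), ∀ y ∈ S, ⁅x, y⁆ ∈ S)
    (hne : ∃ δ : H.root, b.IsPos δ ∧ ∃ x ∈ rootSpace H (δ.1 : H → K), ∃ y ∈ S, ⁅x, y⁆ ≠ 0) :
    ∃ θ : H.root, b.IsPos θ ∧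
      (∀ δ, b.IsPos δ → (rootSystem H).root θ + (rootSystem H).root δ ∉
        Set.range (rootSystem H).root) ∧
      ∃ i : b.support, (rootSystem H).root θ - (rootSystem H).root i ∈
        Set.range (rootSystem H).root ∧
        ∃ x ∈ rootSpace H (i.1.1 : H → K), ∃ y ∈ S, ⁅x, y⁆ ≠ 0 := by
  obtain ⟨δ, hδ, x, hx, y, hy, hxy⟩ := hne
  let T : Set H.root := {θ | b.IsPos θ ∧ ∃ f ∈ rootSpace H (-(θ.1 : H → K)), ∃ δ : H.root,
    b.IsPos δ ∧ ∃ x ∈ rootSpace H (δ.1 : H → K), ∃ y ∈ S, killingForm K 𝔰 f ⁅x, y⁆ ≠ 0}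
  have hT : T.Nonempty := by
    obtain ⟨θ, hθ, f, hf, h⟩ := exists_killingForm_ne_zero (hS _ (hlie δ hδ x hx y hy)) hxy
    exact ⟨θ, hθ, f, hf, δ, hδ, x, hx, y, hy, h⟩
  obtain ⟨θ, ⟨hθ, f, hf, δ, hδ, x, hx, y, hy, hxy⟩, hθmax⟩ :=
    T.toFinite.exists_maximalFor b.height T hT
  refine ⟨θ, hθ, fun δ' hδ' ⟨ρ, hρ⟩ ↦ ?_, ?_⟩
  · -- `f = [f', e]` with `f'` of weight `-ρ = -(θ + δ')`, so that `ρ` could replace `θ`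
    have hρ' : (ρ.1 : H → K) = θ.1 + δ'.1 := funext fun t ↦ by
      simpa using congrArg (fun φ : Module.Dual K H ↦ φ t) hρ
    obtain ⟨f', hf', e, he, rfl⟩ := exists_lie_eq_of_mem_rootSpace (α := -ρ.1) (β := δ'.1)
      (γ := -θ.1) (H.isNonZero_coe_root ρ).neg (H.isNonZero_coe_root θ).neg
      (by rw [Weight.coe_neg, Weight.coe_neg, hρ']; abel) hf
    rw [LieModule.traceForm_apply_lie_apply] at hxy
    have hρpos : b.IsPos ρ := hθ.add hδ' hρ
    have := hθmax ⟨hρpos, f', hf', δ', hδ', e, he, _, hlie δ hδ x hx y hy, hxy⟩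
    have h₁ := b.height_add hρ
    have h₂ : 0 < b.height δ' := hδ'
    lia
  · -- the simple root spaces generate `𝔫⁺`, so `x` may be taken in one of them
    obtain ⟨i, x, hx, y, hy, hxy⟩ : ∃ i : b.support, ∃ x ∈ rootSpace H (i.1.1 : H → K), ∃ y ∈ S,
        killingForm K 𝔰 f ⁅x, y⁆ ≠ 0 := by
      suffices h : b.IsPos δ → ∀ x ∈ rootSpace H (δ.1 : H → K), ∀ y ∈ S,
          killingForm K 𝔰 f ⁅x, y⁆ ≠ 0 → ∃ i : b.support, ∃ x ∈ rootSpace H (i.1.1 : H → K),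
            ∃ y ∈ S, killingForm K 𝔰 f ⁅x, y⁆ ≠ 0 from h hδ x hx y hy hxy
      refine hδ.induction_on_add (p := fun δ ↦ b.IsPos δ → ∀ x ∈ rootSpace H (δ.1 : H → K),
        ∀ y ∈ S, killingForm K 𝔰 f ⁅x, y⁆ ≠ 0 → ∃ i : b.support,
          ∃ x ∈ rootSpace H (i.1.1 : H → K), ∃ y ∈ S, killingForm K 𝔰 f ⁅x, y⁆ ≠ 0)
        (fun i hi _ x hx y hy hxy ↦ ⟨⟨i, hi⟩, x, hx, y, hy, hxy⟩)
        fun δ₁ j δ hsum ih hj hδ x hx y hy hxy ↦ ?_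
      have hδ₁ : b.IsPos δ₁ := hδ.sub hj (by rw [hsum]; abel)
      obtain ⟨x₁, hx₁, e, he, rfl⟩ := exists_lie_eq_of_mem_rootSpace
        (H.isNonZero_coe_root δ₁) (H.isNonZero_coe_root δ) (funext fun t ↦ by
          simpa using congrArg (fun φ : Module.Dual K H ↦ φ t) hsum) hx
      have hjpos := RootPairing.Base.isPos_of_mem_support hj
      rw [lie_lie, map_sub] at hxy
      by_cases h₁ : killingForm K 𝔰 f ⁅x₁, ⁅e, y⁆⁆ = 0
      · rw [h₁, zero_sub, neg_ne_zero] at hxy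
        exact ⟨⟨j, hj⟩, e, he, _, hlie δ₁ hδ₁ x₁ hx₁ y hy, hxy⟩
      · exact ih hδ₁ x₁ hx₁ _ (hlie j hjpos e he y hy) h₁
    refine ⟨i, ?_, x, hx, y, hy, fun h ↦ hxy (by rw [h, map_zero])⟩
    have hfx : ⁅f, x⁆ ∈ rootSpace H (-(θ.1 : H → K) + i.1.1) :=
      lie_mem_genWeightSpace_of_mem_genWeightSpace hf hx
    rw [← LieModule.traceForm_apply_lie_apply] at hxy
    by_cases h₀ : -(θ.1 : H → K) + i.1.1 = 0
    · rw [h₀] at hfx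
      exact absurd (killingForm_eq_zero_of_mem_rootSpace_zero hfx (hS y hy)) hxy
    · have hbot : rootSpace H (-(θ.1 : H → K) + i.1.1) ≠ ⊥ := fun h ↦ hxy (by
        rw [h, LieSubmodule.mem_bot] at hfx
        simp [hfx])
      rw [← RootPairing.neg_mem_range_root_iff]
      obtain ⟨ρ, hρ⟩ := exists_root_coe_eq h₀ hbot
      refine ⟨ρ, ?_⟩
      ext t
      have := congrFun hρ t
      simp only [Pi.add_apply, Pi.neg_apply] at this
      simp
      linear_combination this

/-- Away from type `C`, an ideal of `𝔫⁺` with the double bracket condition commutes with every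
simple root space `𝔰_α` for which `θ - α` is a root, `θ` a highest root; hence it is central. -/
lemma le_center_of_doubleBracketCondition
    (hC : ¬ HasComponentOfTypeC b.cartanMatrix)
    {𝔞 : LieIdeal K (positiveNilpotentSubalgebra b)} (h𝔞 : DoubleBracketCondition 𝔞) :
    𝔞 ≤ LieAlgebra.center K (positiveNilpotentSubalgebra b) := by
  intro y hy
  rw [LieModule.mem_maxTrivSubmodule]
  by_contra! hne
  obtain ⟨u, hu⟩ := hne
  let S : Set 𝔰 := {y | ∃ a ∈ 𝔞, (a : 𝔰) = y}
  obtain ⟨θ, hθ, hmax, i, hi, x, hx, z, ⟨a, ha, rfl⟩, hxz⟩ :=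
    exists_simple_lie_ne_zero (b := b) (S := S) (by rintro _ ⟨a, -, rfl⟩; exact a.2)
    (by
      rintro δ hδ x hx _ ⟨a, ha, rfl⟩
      exact ⟨_, lie_mem_right K _ 𝔞 ⟨x, rootSpace_le_positiveNilpotentSubalgebra hδ hx⟩ a ha, rfl⟩)
    (by
      by_contra! hcon
      refine hu (Subtype.ext ?_)
      refine positiveNilpotentSubalgebra_induction (p := fun u ↦ ⁅u, (y : 𝔰)⁆ = 0) u.2
        (fun δ hδ x hx ↦ hcon δ hδ x hx _ ⟨y, hy, rfl⟩) (zero_lie _)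
        fun v w hv hw ↦ by rw [add_lie, hv, hw, add_zero])
  have hpos := RootPairing.Base.isPos_of_mem_support i.2
  have hlong := RootPairing.Base.IsPos.isLong_of_not_hasComponentOfTypeC hθ hmax hi hC
  refine hxz (congrArg Subtype.val <|
    h𝔞 ⟨x, rootSpace_le_positiveNilpotentSubalgebra hpos hx⟩ (fun c _ ↦ Subtype.ext ?_) a ha)
  exact lie_lie_eq_zero_of_isLong hpos hlong hx c.2

end NilpotentControl

theorem theorem4p5 (p : ℕ) [Fact p.Prime]
    (𝔰 : Type*) [LieRing 𝔰] [LieAlgebra ℚ_[p] 𝔰] [FiniteDimensional ℚ_[p] 𝔰]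
    [LieAlgebra.IsSemisimple ℚ_[p] 𝔰]
    (H : LieSubalgebra ℚ_[p] 𝔰) [H.IsCartanSubalgebra]
    [LieModule.IsTriangularizable ℚ_[p] H 𝔰]
    (b : (LieAlgebra.IsKilling.rootSystem H).Base)
    (hC : ¬ NilpotentControl.HasComponentOfTypeC b.cartanMatrix) :
    NilpotentControl.bIdeal ℚ_[p] (NilpotentControl.positiveNilpotentSubalgebra b) =
      LieAlgebra.center ℚ_[p] (NilpotentControl.positiveNilpotentSubalgebra b) := by
  refine le_antisymm (NilpotentControl.le_center_of_doubleBracketCondition hC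
    (NilpotentControl.bIdeal_isGreatest _ _).1)
    ((NilpotentControl.bIdeal_isGreatest _ _).2 fun x _ a ha ↦ ?_)
  exact (LieModule.mem_maxTrivSubmodule _ _ _ a).mp ha x
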